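/- **Multi-plank stratification.** Let $V\subset\mathbb{R}^n$ be a finite set of at least two points whose affine hull is $\mathbb{R}^n$ and such that the closed ball with the smallest radius containing $V$ is centered at the origin, and let $$P=\{x\in\mathbb{R}^n \mid \forall v\in V\ \exists v'\in V:\ |x|<|x-v+v'|\}$$ be the open centered multi-plank generated by $V$. Let $\Sigma$ be an anti-Delaunay (farthest-point Delaunay) triangulation of $\operatorname{conv}V$, i.e. a finite geometric simplicial complex with underlying space $\operatorname{conv}V$ such that, for each $n$-dimensional cell $\sigma$ of $\Sigma$, the closed ball whose boundary sphere passes through the vertices of $\sigma$ contains $V$. For each $n$-dimensional cell $\sigma$ let $S_\sigma$ be the translated copy of $\sigma$ such that the origin is equidistant from the vertices of $S_\sigma$, and for each cell $\tau\subseteq\sigma$ of $\Sigma$ with $\dim \tau>0$ let $T_{\tau,\sigma}$ be the face of $S_\sigma$ that is the image of $\tau$ under the same translation. For a face $F$ of a convex body $T$ let $N_T(F)=\{\nu\in\mathbb{R}^n \mid \langle\nu,y-x\rangle\le 0\ \ \forall y\in T\}$ be the cone of outer normals of $T$ at any point $x$ of the relative interior of $F$ (it does not depend on $x$). For each cell $\tau$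 of $\Sigma$ with $\dim\tau>0$ put $$P_\tau=\bigcap_{\sigma\supseteq\tau}\bigl(\operatorname{rint}T_{\tau,\sigma}+N_{S_\sigma}(T_{\tau,\sigma})\bigr),$$ where the intersection is over all $n$-dimensional cells $\sigma$ of $\Sigma$ containing $\tau$ and $+$ is the Minkowski sum. Then $$P=\bigcup_{d=1}^{n}\ \bigcup_{\dim\tau=d}P_\tau,$$ where the inner union is over all cells $\tau$ of $\Sigma$ of dimension $d$, and the strata $P_\tau$ belonging to distinct cells $\tau$ of positive dimension are disjoint. -/

import Mathlib

open scoped Pointwise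

namespace MultiPlank

noncomputable section

/-- `V` is a generating set of a centered multi-plank: it has at least two points, and the closed
ball with the smallest radius containing `V` is centered at the origin. -/
structure IsCenteredGeneratingSet {n : ℕ} (V : Finset (EuclideanSpace ℝ (Fin n))) : Prop where
  two_le_card : 2 ≤ V.card
  smallest_ball : ∃ r : ℝ, (V : Set (EuclideanSpace ℝ (Fin n))) ⊆ Metric.closedBall 0 r ∧
    ∀ (c : EuclideanSpace ℝ (Fin n)) (s : ℝ),
      (V : Set (EuclideanSpace ℝ (Fin n))) ⊆ Metric.closedBall c s → r ≤ s

/-- The open centered multi-plank generated by `V`. -/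
def openMultiPlank {n : ℕ} (V : Finset (EuclideanSpace ℝ (Fin n))) :
    Set (EuclideanSpace ℝ (Fin n)) :=
  {x | ∀ v ∈ V, ∃ v' ∈ V, ‖x‖ < ‖x - v + v'‖}

/-- The finite set `V` has full rank: its affine hull is the whole space. -/
def HasFullRank {n : ℕ} (V : Finset (EuclideanSpace ℝ (Fin n))) : Prop :=
  affineSpan ℝ (V : Set (EuclideanSpace ℝ (Fin n))) = ⊤

/-- An anti-Delaunay (farthest-point Delaunay) triangulation of the convex hull of a full-rank
set `V`: a finite geometric simplicial complex whose underlying space is `conv V` and which has the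
full sphere property, that is, for each top-dimensional cell `σ`, the closed ball whose boundary
sphere passes through the vertices of `σ` contains `V`. Cells are recorded by their vertex sets, so
that a cell of dimension `d` is a face with `d + 1` vertices. -/
structure IsAntiDelaunay {n : ℕ} (V : Finset (EuclideanSpace ℝ (Fin n)))
    (K : Geometry.SimplicialComplex ℝ (EuclideanSpace ℝ (Fin n))) : Prop where
  finite_faces : K.faces.Finite
  space_eq : K.space = convexHull ℝ (V : Set (EuclideanSpace ℝ (Fin n)))
  full_sphere : ∀ σ ∈ K.faces, σ.card = n + 1 →
    ∀ (c : EuclideanSpace ℝ (Fin n)) (r : ℝ), (∀ u ∈ σ, dist u c = r) →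
      (V : Set (EuclideanSpace ℝ (Fin n))) ⊆ Metric.closedBall c r

open Classical in
/-- The circumcenter of the simplex with vertex set `s`: the point of the affine hull of `s`
equidistant from all points of `s` (and `0` if `s` is not the vertex set of a simplex). -/
def circumcenter {n : ℕ} (s : Finset (EuclideanSpace ℝ (Fin n))) : EuclideanSpace ℝ (Fin n) :=
  if h : Nonempty s ∧ AffineIndependent ℝ ((↑) : s → EuclideanSpace ℝ (Fin n)) then
    (haveI := h.1; h.2.existsUnique_dist_eq.choose.center)
  else 0

/-- The circumcenter of a simplex is equidistant from its vertices. -/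
theorem exists_dist_circumcenter_eq {n : ℕ} {s : Finset (EuclideanSpace ℝ (Fin n))}
    (h : AffineIndependent ℝ ((↑) : s → EuclideanSpace ℝ (Fin n))) :
    ∃ r : ℝ, ∀ u ∈ s, dist u (circumcenter s) = r := by
  classical
  by_cases hs : Nonempty s
  · refine ⟨(h.existsUnique_dist_eq.choose).radius, fun u hu => ?_⟩
    rw [circumcenter, dif_pos ⟨hs, h⟩]
    exact h.existsUnique_dist_eq.choose_spec.1.2 ⟨⟨u, hu⟩, rfl⟩
  · exact ⟨0, fun u hu => (hs ⟨⟨u, hu⟩⟩).elim⟩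

/-- The face `T_{τ,σ}` of the recentred simplex `S_σ`: the copy of the simplex with vertex set `τ`
under the translation that moves the circumcenter of `σ` to the origin. -/
def recentredFace {n : ℕ} (τ σ : Finset (EuclideanSpace ℝ (Fin n))) :
    Set (EuclideanSpace ℝ (Fin n)) :=
  (fun y => y - circumcenter σ) '' convexHull ℝ (τ : Set (EuclideanSpace ℝ (Fin n)))

/-- The recentred simplex `S_σ`: the translated copy of the simplex with vertex set `σ` such that
the origin is equidistant from its vertices. -/
def recentredSimplex {n : ℕ} (σ : Finset (EuclideanSpace ℝ (Fin n))) :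
    Set (EuclideanSpace ℝ (Fin n)) :=
  recentredFace σ σ

/-- The cone of outer normals `N_T(x)` of `T` at the point `x`. -/
def normalCone {n : ℕ} (T : Set (EuclideanSpace ℝ (Fin n))) (x : EuclideanSpace ℝ (Fin n)) :
    Set (EuclideanSpace ℝ (Fin n)) :=
  {ν | ∀ y ∈ T, inner ℝ ν (y - x) ≤ 0}

/-- The cone of outer normals `N_T(F)` of `T` at a face `F`: the normals at the points of the
relative interior of `F` (for a face `F` of a convex body `T`, `N_T(x)` is the same cone for all
such points `x`). -/
def faceNormalCone {n : ℕ} (T F : Set (EuclideanSpace ℝ (Fin n))) :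
    Set (EuclideanSpace ℝ (Fin n)) :=
  {ν | ∀ x ∈ intrinsicInterior ℝ F, ν ∈ normalCone T x}

/-- The stratum `P_τ`: the intersection, over all top-dimensional cells `σ` containing `τ`, of the
Minkowski sums `rint T_{τ,σ} + N_{S_σ}(T_{τ,σ})`. -/
def stratum {n : ℕ} (K : Geometry.SimplicialComplex ℝ (EuclideanSpace ℝ (Fin n)))
    (τ : Finset (EuclideanSpace ℝ (Fin n))) : Set (EuclideanSpace ℝ (Fin n)) :=
  ⋂ σ ∈ {σ | σ ∈ K.faces ∧ σ.card = n + 1 ∧ τ ⊆ σ},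
    (intrinsicInterior ℝ (recentredFace τ σ) +
      faceNormalCone (recentredSimplex σ) (recentredFace τ σ))

end

end MultiPlank

/-!
The strata are the fibres of a projection. Let `g` be the function on `conv V` that interpolates
`‖·‖ ^ 2` linearly on the cells of the triangulation. On a top-dimensional cell `σ` with circumcenter
`c` it is `2 ⟪c, y⟫` plus a constant, and the full sphere property says that the power with respect
to the circumsphere of `σ`, nonpositive on `V`, is largest for the cell containing the given point
(`power_le_power`). Hence `g` is concave, and `y ↦ ‖y - x‖ ^ 2 - g y` is strictly convex with a unique
minimizer `t` on `conv V`. Concavity enters as the monotonicity `inner_circumcenter_sub_nonneg`, and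
minimality as the variational inequality `IsCritical`: for every `σ` around `t`, the point `t` is the
nearest point of `σ` to `x + c`. Existence and uniqueness are `exists_isCritical` and
`IsCritical.unique`.

By definition of the Minkowski sums, `x` lies in the stratum of `τ` if and only if for every `σ ⊇ τ`
the nearest point of `σ` to `x + c` is in the relative interior of `τ`. By monotonicity these nearest
points agree for all such `σ`, so the condition is that the minimizer is in the open cell of `τ`
(`mem_stratum_iff`). The open cells partition `conv V`, hence the strata of all cells, vertices
included, partition the space.

It remains to identify the strata of the vertices with the complement of the multi-plank. The point
`x` is outside if and only if some `v ∈ V` satisfies `2 ⟪x, w - v⟫ + ‖w - v‖ ^ 2 ≤ 0` for all `w ∈ V`,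
and this is equivalent to the minimizer being `v` (`IsCritical.notMem_openMultiPlank`,
`IsCritical.eq_of_inner_add_sq_le`). Such a `v` is extreme in `conv V`, so that its open cell is a
vertex (`card_le_one_of_inner_add_sq_le`).
-/

open scoped Pointwise

namespace MultiPlank

/-! ### Relative interiors of convex sets and simplices -/

section RelativeInterior

variable {E : Type*} [NormedAddCommGroup E] [NormedSpace ℝ E]

theorem mem_intrinsicInterior_iff_dist {C : Set E} {t : E} :
    t ∈ intrinsicInterior ℝ C ↔ t ∈ affineSpan ℝ C ∧
      ∃ ε > 0, ∀ y ∈ affineSpan ℝ C, dist y t < ε → y ∈ C := by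
  rw [mem_intrinsicInterior]
  constructor
  · rintro ⟨y, hy, rfl⟩
    rw [mem_interior_iff_mem_nhds, Metric.mem_nhds_iff] at hy
    obtain ⟨ε, hε, h⟩ := hy
    exact ⟨y.2, ε, hε, fun z hz hd => @h ⟨z, hz⟩ hd⟩
  · rintro ⟨ht, ε, hε, h⟩
    refine ⟨⟨t, ht⟩, ?_, rfl⟩
    rw [mem_interior_iff_mem_nhds, Metric.mem_nhds_iff]
    exact ⟨ε, hε, fun z hz => h z z.2 hz⟩

/-- A segment ending at a point of the relative interior can be prolonged within the set. -/
theorem exists_prolong_mem {C : Set E} {t u : E} (ht : t ∈ intrinsicInterior ℝ C) (hu : u ∈ C) :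
    ∃ ε : ℝ, 0 < ε ∧ t + ε • (t - u) ∈ C := by
  obtain ⟨hts, ε, hε, h⟩ := mem_intrinsicInterior_iff_dist.1 ht
  have hpos : 0 < ‖t - u‖ + 1 := by positivity
  refine ⟨ε / (‖t - u‖ + 1), by positivity, h _ ?_ ?_⟩
  · have := AffineMap.lineMap_mem (-(ε / (‖t - u‖ + 1))) hts (subset_affineSpan ℝ C hu)
    convert this using 1
    rw [AffineMap.lineMap_apply_module']
    module
  · rw [dist_eq_norm, add_sub_cancel_left, norm_smul, Real.norm_of_nonneg (by positivity),
      div_mul_eq_mul_div, div_lt_iff₀ hpos]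
    nlinarith

theorem add_smul_sub_mem_intrinsicInterior {C : Set E} (hC : Convex ℝ C) {p q : E} {r : ℝ}
    (hp : p ∈ intrinsicInterior ℝ C) (hq : q ∈ C) (hr : 0 < r) (hr1 : r ≤ 1) :
    q + r • (p - q) ∈ intrinsicInterior ℝ C := by
  obtain ⟨hps, ε, hε, h⟩ := mem_intrinsicInterior_iff_dist.1 hp
  have hqs := subset_affineSpan ℝ C hq
  refine mem_intrinsicInterior_iff_dist.2 ⟨?_, r * ε, by positivity, fun y hy hd => ?_⟩
  · have := AffineMap.lineMap_mem r hqs hps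
    rwa [AffineMap.lineMap_apply_module', add_comm] at this
  · have hz := AffineMap.lineMap_mem r⁻¹ hqs hy
    rw [AffineMap.lineMap_apply_module'] at hz
    have hzC := h _ hz (by
      have : r⁻¹ • (y - q) + q - p = r⁻¹ • (y - (q + r • (p - q))) := by
        match_scalars <;> field_simp
        ring
      rw [dist_eq_norm, this, norm_smul, ← dist_eq_norm, Real.norm_of_nonneg (by positivity),
        inv_mul_lt_iff₀ hr]
      exact hd)
    have := hC hq hzC (sub_nonneg.2 hr1) hr.le (by ring)
    convert this using 1
    match_scalars <;> field_simp
    ring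

theorem sum_smul_mem_intrinsicInterior_convexHull [FiniteDimensional ℝ E] {τ : Finset E}
    {w : E → ℝ} (hw : ∀ u ∈ τ, 0 < w u) (h1 : ∑ u ∈ τ, w u = 1) :
    ∑ u ∈ τ, w u • u ∈ intrinsicInterior ℝ (convexHull ℝ (τ : Set E)) := by
  classical
  have hne : τ.Nonempty := by
    rw [Finset.nonempty_iff_ne_empty]
    rintro rfl
    simp at h1
  have hcv := convex_convexHull ℝ (τ : Set E)
  obtain ⟨p, hp⟩ := Set.Nonempty.intrinsicInterior hcv
    (convexHull_nonempty_iff.2 (Finset.coe_nonempty.2 hne))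
  obtain ⟨m, hm0, hm1, hmp⟩ := Finset.mem_convexHull'.1 (intrinsicInterior_subset hp)
  obtain ⟨a, ha, hmin⟩ := Finset.exists_min_image τ w hne
  have hδ := hw a ha
  -- Prolonging the segment from `p` by the least weight keeps all the weights nonnegative.
  have hq : ∑ u ∈ τ, (w u + w a * (w u - m u)) • u ∈ convexHull ℝ (τ : Set E) := by
    refine Finset.mem_convexHull'.2 ⟨_, fun u hu => ?_, ?_, rfl⟩
    · have h2 : m u ≤ 1 := hm1 ▸ Finset.single_le_sum hm0 hu
      have h3 := hmin u hu
      nlinarith [hw u hu]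
    · simp only [mul_sub, Finset.sum_add_distrib, Finset.sum_sub_distrib, ← Finset.mul_sum, h1, hm1]
      ring
  have key := add_smul_sub_mem_intrinsicInterior hcv (r := w a / (1 + w a)) hp hq (by positivity)
    (by rw [div_le_one (by positivity)]; linarith)
  convert key using 1
  have e : ∑ u ∈ τ, (w u + w a * (w u - m u)) • u =
      ∑ u ∈ τ, w u • u + w a • (∑ u ∈ τ, w u • u - p) := by
    rw [← hmp]
    simp only [add_smul, mul_smul, sub_smul, Finset.sum_add_distrib, Finset.sum_sub_distrib,
      ← Finset.smul_sum]
  rw [e]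
  have : 1 + w a ≠ 0 := by positivity
  match_scalars <;> field_simp <;> ring

end RelativeInterior

/-! ### Open cells of a simplicial complex -/

section Complex

variable {E : Type*} [NormedAddCommGroup E] [NormedSpace ℝ E] {K : Geometry.SimplicialComplex ℝ E}

/-- The open cells of a complex cover its underlying space. -/
theorem exists_face_mem_intrinsicInterior [FiniteDimensional ℝ E] {t : E} (ht : t ∈ K.space) :
    ∃ τ ∈ K.faces, t ∈ intrinsicInterior ℝ (convexHull ℝ (τ : Set E)) := by
  classical
  obtain ⟨s, hs, hts⟩ := Geometry.SimplicialComplex.mem_space_iff.1 ht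
  obtain ⟨w, hw0, hw1, rfl⟩ := Finset.mem_convexHull'.1 hts
  have hsub : s.filter (fun u => 0 < w u) ⊆ s := Finset.filter_subset _ _
  have hz : ∀ u ∈ s, u ∉ s.filter (fun u => 0 < w u) → w u = 0 := fun u hu hu' =>
    le_antisymm (not_lt.1 fun h => hu' (Finset.mem_filter.2 ⟨hu, h⟩)) (hw0 u hu)
  have h1 : ∑ u ∈ s.filter (fun u => 0 < w u), w u = 1 := by
    rw [Finset.sum_subset hsub hz, hw1]
  refine ⟨s.filter (fun u => 0 < w u), K.down_closed hs hsub ?_, ?_⟩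
  · rw [Finset.nonempty_iff_ne_empty]
    intro h
    simp [h] at h1
  · rw [← Finset.sum_subset hsub fun u hu hu' => by rw [hz u hu hu', zero_smul]]
    exact sum_smul_mem_intrinsicInterior_convexHull (fun u hu => (Finset.mem_filter.1 hu).2) h1

/-- A cell of a complex contains every cell whose relative interior it meets. -/
theorem face_subset_of_mem_intrinsicInterior {τ σ : Finset E} (hτ : τ ∈ K.faces) (hσ : σ ∈ K.faces)
    {t : E} (ht : t ∈ intrinsicInterior ℝ (convexHull ℝ (τ : Set E)))
    (hts : t ∈ convexHull ℝ (σ : Set E)) : τ ⊆ σ := by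
  classical
  intro u hu
  by_contra hus
  have hint := K.inter_subset_convexHull hτ hσ ⟨intrinsicInterior_subset ht, hts⟩
  rw [← Finset.coe_inter] at hint
  obtain ⟨w, hw0, hw1, hwt⟩ := Finset.mem_convexHull'.1 hint
  obtain ⟨ε, hε, hy⟩ := exists_prolong_mem ht (subset_convexHull ℝ _ (Finset.mem_coe.2 hu))
  obtain ⟨m, hm0, hm1, hmy⟩ := Finset.mem_convexHull'.1 hy
  -- Two barycentric expressions of `(1 + ε) • t`, whose weights at `u` are `0` and at least `ε`.
  have key := (K.indep hτ).eq_of_sum_eq_sum_subtype (s := τ)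
    (w₁ := fun v => (1 + ε) * if v ∈ τ ∩ σ then w v else 0)
    (w₂ := fun v => m v + ε * if v = u then 1 else 0) ?_ ?_ u hu
  · simp [hu, hus] at key
    linarith [hm0 u hu]
  · simp only [← Finset.mul_sum, Finset.sum_add_distrib, hm1, Finset.sum_ite_mem,
      ← Finset.inter_assoc, Finset.inter_self, hw1, Finset.sum_ite_eq', hu, if_true]
    ring
  · simp only [mul_smul, add_smul, ← Finset.smul_sum, Finset.sum_add_distrib, hmy, ite_smul,
      zero_smul, one_smul, Finset.sum_ite_mem, ← Finset.inter_assoc, Finset.inter_self, hwt,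
      Finset.sum_ite_eq', hu, if_true]
    module

end Complex

/-! ### Top-dimensional cells of an anti-Delaunay triangulation -/

section TopCells

variable {n : ℕ} {V : Finset (EuclideanSpace ℝ (Fin n))}
  {K : Geometry.SimplicialComplex ℝ (EuclideanSpace ℝ (Fin n))}

/-- The `n`-dimensional cells of a complex in `ℝⁿ`, recorded by their vertex sets. -/
def topCells (K : Geometry.SimplicialComplex ℝ (EuclideanSpace ℝ (Fin n))) :
    Set (Finset (EuclideanSpace ℝ (Fin n))) :=
  {σ | σ ∈ K.faces ∧ σ.card = n + 1}

theorem card_face_le {τ : Finset (EuclideanSpace ℝ (Fin n))} (hτ : τ ∈ K.faces) :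
    τ.card ≤ n + 1 := by
  have h := (K.indep hτ).card_le_finrank_succ
  have h2 := Submodule.finrank_le
    (vectorSpan ℝ (Set.range ((↑) : τ → EuclideanSpace ℝ (Fin n))))
  rw [finrank_euclideanSpace_fin] at h2
  rw [Fintype.card_coe] at h
  omega

open MeasureTheory in
/-- The simplex spanned by a cell of lower dimension is a null set. -/
theorem volume_convexHull_eq_zero {τ : Finset (EuclideanSpace ℝ (Fin n))} (hτ : τ ∈ K.faces)
    (hc : τ.card ≠ n + 1) : volume (convexHull ℝ (τ : Set (EuclideanSpace ℝ (Fin n)))) = 0 := by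
  have hne : affineSpan ℝ (τ : Set (EuclideanSpace ℝ (Fin n))) ≠ ⊤ := by
    intro h
    have := (K.indep hτ).affineSpan_eq_top_iff_card_eq_finrank_add_one
    rw [Fintype.card_coe, finrank_euclideanSpace_fin, Subtype.range_coe_subtype] at this
    exact hc (this.1 h)
  exact measure_mono_null (convexHull_subset_affineSpan _) (Measure.addHaar_affineSubspace _ _ hne)

open MeasureTheory in
/-- The top-dimensional cells cover: what they miss would be a relatively open part of `conv V`
covered by finitely many null sets. -/
theorem exists_topCell_mem (hrank : HasFullRank V) (hK : IsAntiDelaunay V K)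
    {t : EuclideanSpace ℝ (Fin n)} (ht : t ∈ K.space) :
    ∃ σ ∈ topCells K, t ∈ convexHull ℝ (σ : Set (EuclideanSpace ℝ (Fin n))) := by
  set A := ⋃ σ ∈ topCells K, convexHull ℝ (σ : Set (EuclideanSpace ℝ (Fin n))) with hA
  suffices h : t ∈ A by simpa [hA] using h
  have hfin : (topCells K).Finite := hK.finite_faces.subset fun σ h => h.1
  have hclosed : IsClosed A :=
    hfin.isClosed_biUnion fun σ _ => (Finset.finite_toSet σ).isClosed_convexHull ℝ
  by_contra htA
  have hcv := convex_convexHull ℝ (V : Set (EuclideanSpace ℝ (Fin n)))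
  have hint : (interior (convexHull ℝ (V : Set (EuclideanSpace ℝ (Fin n))))).Nonempty :=
    interior_convexHull_nonempty_iff_affineSpan_eq_top.2 hrank
  have htc : t ∈ closure (interior (convexHull ℝ (V : Set (EuclideanSpace ℝ (Fin n))))) := by
    rw [hcv.closure_interior_eq_closure_of_nonempty_interior hint, ← hK.space_eq]
    exact subset_closure ht
  have hU : (Aᶜ ∩ interior (convexHull ℝ (V : Set (EuclideanSpace ℝ (Fin n))))).Nonempty :=
    mem_closure_iff.1 htc _ hclosed.isOpen_compl htA
  refine ((hclosed.isOpen_compl.inter isOpen_interior).measure_pos volume hU).ne' ?_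
  refine measure_mono_null (t := ⋃ τ ∈ K.faces \ topCells K,
    convexHull ℝ (τ : Set (EuclideanSpace ℝ (Fin n)))) ?_ ?_
  · rintro y ⟨hyA, hy⟩
    have hyK : y ∈ K.space := hK.space_eq ▸ interior_subset hy
    obtain ⟨s, hs, hys⟩ := Geometry.SimplicialComplex.mem_space_iff.1 hyK
    exact Set.mem_biUnion ⟨hs, fun h => hyA (Set.mem_biUnion h hys)⟩ hys
  · refine (measure_biUnion_null_iff (hK.finite_faces.subset Set.sdiff_subset).countable).2 ?_
    exact fun τ hτ => volume_convexHull_eq_zero hτ.1 fun h => hτ.2 ⟨hτ.1, h⟩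

/-- A segment in `conv V` starts out within a top-dimensional cell containing its first endpoint. -/
theorem exists_topCell_initial_segment (hrank : HasFullRank V) (hK : IsAntiDelaunay V K)
    {t u : EuclideanSpace ℝ (Fin n)} (ht : t ∈ K.space) (hu : u ∈ K.space) :
    ∃ σ ∈ topCells K, t ∈ convexHull ℝ (σ : Set (EuclideanSpace ℝ (Fin n))) ∧
      ∃ s : ℝ, 0 < s ∧ t + s • (u - t) ∈ convexHull ℝ (σ : Set (EuclideanSpace ℝ (Fin n))) := by
  have hfin : (topCells K).Finite := hK.finite_faces.subset fun σ h => h.1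
  have hev : ∀ᶠ s : ℝ in nhdsWithin 0 (Set.Ioi 0), ∃ σ ∈ topCells K,
      t + s • (u - t) ∈ convexHull ℝ (σ : Set (EuclideanSpace ℝ (Fin n))) := by
    filter_upwards [Ioo_mem_nhdsGT (zero_lt_one' ℝ)] with s hs
    refine exists_topCell_mem hrank hK ?_
    rw [hK.space_eq] at ht hu ⊢
    exact (convex_convexHull ℝ _).add_smul_sub_mem ht hu ⟨hs.1.le, hs.2.le⟩
  -- Finitely many cells: one of them contains points of the segment arbitrarily close to `t`.
  obtain ⟨σ, hσ, hfr⟩ := (Filter.frequently_exists_finite hfin).1 hev.frequently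
  refine ⟨σ, hσ, ?_, ?_⟩
  · have hcl : IsClosed (convexHull ℝ (σ : Set (EuclideanSpace ℝ (Fin n)))) :=
      (Finset.finite_toSet σ).isClosed_convexHull ℝ
    have hlim : Filter.Tendsto (fun s : ℝ => t + s • (u - t)) (nhdsWithin 0 (Set.Ioi 0))
        (nhds t) := by
      have : Continuous fun s : ℝ => t + s • (u - t) := by fun_prop
      simpa using (this.tendsto 0).mono_left nhdsWithin_le_nhds
    exact hcl.mem_of_frequently_of_tendsto hfr hlim
  · obtain ⟨s, hs, hs0⟩ := (hfr.and_eventually self_mem_nhdsWithin).exists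
    exact ⟨s, hs0, hs⟩

/-! ### The power function and the critical point -/

/-- On the cell `σ'`, among the powers with respect to the circumspheres of top-dimensional cells,
the one of `σ'` itself is the largest: it vanishes at the vertices of `σ'`, where the others are
nonpositive by the full sphere property. -/
theorem power_le_power (hK : IsAntiDelaunay V K) {σ σ' : Finset (EuclideanSpace ℝ (Fin n))}
    (hσ : σ ∈ topCells K) (hσ' : σ' ∈ topCells K) {r r' : ℝ}
    (hr : ∀ u ∈ σ, dist u (circumcenter σ) = r) (hr' : ∀ u ∈ σ', dist u (circumcenter σ') = r')
    {y : EuclideanSpace ℝ (Fin n)} (hy : y ∈ convexHull ℝ (σ' : Set (EuclideanSpace ℝ (Fin n)))) :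
    ‖y - circumcenter σ‖ ^ 2 - r ^ 2 ≤ ‖y - circumcenter σ'‖ ^ 2 - r' ^ 2 := by
  have hball : K.space ⊆ Metric.closedBall (circumcenter σ) r := by
    rw [hK.space_eq]
    exact convexHull_min (hK.full_sphere σ hσ.1 hσ.2 _ r hr) (convex_closedBall _ _)
  have hid : ∀ z : EuclideanSpace ℝ (Fin n),
      ‖z - circumcenter σ‖ ^ 2 - ‖z - circumcenter σ'‖ ^ 2 =
        2 * inner ℝ (circumcenter σ' - circumcenter σ) z +
          (‖circumcenter σ‖ ^ 2 - ‖circumcenter σ'‖ ^ 2) := by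
    intro z
    rw [@norm_sub_sq_real, @norm_sub_sq_real, inner_sub_left,
      real_inner_comm z, real_inner_comm z]
    ring
  -- The difference of the two powers is affine, so it suffices to compare them at the vertices.
  have hhalf : convexHull ℝ (σ' : Set (EuclideanSpace ℝ (Fin n))) ⊆
      {z | inner ℝ (circumcenter σ' - circumcenter σ) z ≤
        (r ^ 2 - r' ^ 2 - (‖circumcenter σ‖ ^ 2 - ‖circumcenter σ'‖ ^ 2)) / 2} := by
    refine convexHull_min (fun u hu => ?_)
      (convex_halfSpace_le (innerₛₗ ℝ (circumcenter σ' - circumcenter σ)).isLinear _)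
    have h1 := hball (K.subset_space hσ'.1 hu)
    have h2 := hr' u hu
    rw [Metric.mem_closedBall, dist_eq_norm] at h1
    rw [dist_eq_norm] at h2
    have h3 : ‖u - circumcenter σ‖ ^ 2 ≤ r ^ 2 := by gcongr
    have h4 := hid u
    rw [h2] at h4
    rw [Set.mem_ofPred_eq]
    linarith
  have h5 := hhalf hy
  rw [Set.mem_ofPred_eq] at h5
  linarith [hid y]

/-- The assignment of `circumcenter σ` to the points of `σ` is monotone decreasing: twice the
circumcenters are the supergradients of the concave function interpolating `‖·‖ ^ 2` linearly on the
cells. -/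
theorem inner_circumcenter_sub_nonneg (hK : IsAntiDelaunay V K)
    {σ σ' : Finset (EuclideanSpace ℝ (Fin n))} (hσ : σ ∈ topCells K) (hσ' : σ' ∈ topCells K)
    {t t' : EuclideanSpace ℝ (Fin n)}
    (ht : t ∈ convexHull ℝ (σ : Set (EuclideanSpace ℝ (Fin n))))
    (ht' : t' ∈ convexHull ℝ (σ' : Set (EuclideanSpace ℝ (Fin n)))) :
    0 ≤ inner ℝ (circumcenter σ - circumcenter σ') (t' - t) := by
  obtain ⟨r, hr⟩ := exists_dist_circumcenter_eq (K.indep hσ.1)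
  obtain ⟨r', hr'⟩ := exists_dist_circumcenter_eq (K.indep hσ'.1)
  have h1 := power_le_power hK hσ hσ' hr hr' ht'
  have h2 := power_le_power hK hσ' hσ hr' hr ht
  simp only [@norm_sub_sq_real] at h1 h2
  simp only [inner_sub_left, inner_sub_right]
  rw [real_inner_comm t', real_inner_comm t, real_inner_comm t', real_inner_comm t]
  linarith

/-- `t` satisfies the variational inequality for the point of `conv V` minimizing the strictly
convex function `y ↦ ‖y - x‖ ^ 2 - g y`, where `g` interpolates `‖·‖ ^ 2` linearly on the cells:
in every top-dimensional cell `σ` around `t`, the point `t` is the nearest to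
`x + circumcenter σ`. -/
def IsCritical (K : Geometry.SimplicialComplex ℝ (EuclideanSpace ℝ (Fin n)))
    (x t : EuclideanSpace ℝ (Fin n)) : Prop :=
  ∀ σ ∈ topCells K, t ∈ convexHull ℝ (σ : Set (EuclideanSpace ℝ (Fin n))) →
    ∀ u ∈ convexHull ℝ (σ : Set (EuclideanSpace ℝ (Fin n))),
      inner ℝ (x + circumcenter σ - t) (u - t) ≤ 0

/-- Strict monotonicity: the variational inequality holds in both directions between two points of
`conv V` only if they coincide. -/
theorem eq_of_inner_le_zero (hK : IsAntiDelaunay V K)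
    {σ σ' : Finset (EuclideanSpace ℝ (Fin n))} (hσ : σ ∈ topCells K) (hσ' : σ' ∈ topCells K)
    {x t t' : EuclideanSpace ℝ (Fin n)}
    (ht : t ∈ convexHull ℝ (σ : Set (EuclideanSpace ℝ (Fin n))))
    (ht' : t' ∈ convexHull ℝ (σ' : Set (EuclideanSpace ℝ (Fin n))))
    (h : inner ℝ (x + circumcenter σ - t) (t' - t) ≤ 0)
    (h' : inner ℝ (x + circumcenter σ' - t') (t - t') ≤ 0) : t = t' := by
  have hm := inner_circumcenter_sub_nonneg hK hσ hσ' ht ht'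
  have hsum : inner ℝ (x + circumcenter σ - t) (t' - t) +
      inner ℝ (x + circumcenter σ' - t') (t - t') =
      inner ℝ (circumcenter σ - circumcenter σ') (t' - t) + ‖t' - t‖ ^ 2 := by
    rw [← neg_sub t' t, inner_neg_right, ← sub_eq_add_neg, ← inner_sub_left,
      ← real_inner_self_eq_norm_sq, ← inner_add_left]
    congr 1
    abel
  have h0 : ‖t' - t‖ ^ 2 = 0 := le_antisymm (by linarith) (sq_nonneg _)
  exact (sub_eq_zero.1 (norm_eq_zero.1 (pow_eq_zero_iff two_ne_zero |>.1 h0))).symm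

/-- At a critical point, the variational inequality in the direction of any point of `conv V`
holds for some top-dimensional cell. -/
theorem IsCritical.exists_topCell_inner_le (hrank : HasFullRank V) (hK : IsAntiDelaunay V K)
    {x t u : EuclideanSpace ℝ (Fin n)} (h : IsCritical K x t) (ht : t ∈ K.space)
    (hu : u ∈ K.space) :
    ∃ σ ∈ topCells K, t ∈ convexHull ℝ (σ : Set (EuclideanSpace ℝ (Fin n))) ∧
      inner ℝ (x + circumcenter σ - t) (u - t) ≤ 0 := by
  obtain ⟨σ, hσ, htσ, s, hs, hsσ⟩ := exists_topCell_initial_segment hrank hK ht hu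
  refine ⟨σ, hσ, htσ, ?_⟩
  have := h σ hσ htσ _ hsσ
  rw [add_sub_cancel_left, inner_smul_right] at this
  exact nonpos_of_mul_nonpos_right this hs

theorem IsCritical.unique (hrank : HasFullRank V) (hK : IsAntiDelaunay V K)
    {x t t' : EuclideanSpace ℝ (Fin n)} (h : IsCritical K x t) (h' : IsCritical K x t')
    (ht : t ∈ K.space) (ht' : t' ∈ K.space) : t = t' := by
  obtain ⟨σ, hσ, htσ, h1⟩ := h.exists_topCell_inner_le hrank hK ht ht'
  obtain ⟨σ', hσ', htσ', h2⟩ := h'.exists_topCell_inner_le hrank hK ht' ht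
  exact eq_of_inner_le_zero hK hσ hσ' htσ htσ' h1 h2

/-- The function `y ↦ ‖y - x‖ ^ 2 - g y`, with `g` as in `IsCritical`, attains its minimum on the
union of the top-dimensional cells, and a minimizer is critical. On the cell with circumcenter `c`
it is `‖y - (x + c)‖ ^ 2` up to a constant. -/
theorem exists_isCritical (hrank : HasFullRank V) (hK : IsAntiDelaunay V K)
    (x : EuclideanSpace ℝ (Fin n)) : ∃ t ∈ K.space, IsCritical K x t := by
  classical
  have hfin : (topCells K).Finite := hK.finite_faces.subset fun σ h => h.1
  have hVne : (V : Set (EuclideanSpace ℝ (Fin n))).Nonempty := by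
    rw [← affineSpan_nonempty ℝ, hrank]
    exact ⟨0, trivial⟩
  obtain ⟨v, hv⟩ := hVne
  obtain ⟨σ₁, hσ₁, -⟩ := exists_topCell_mem hrank hK
    (hK.space_eq ▸ subset_convexHull ℝ _ hv : v ∈ K.space)
  have hrad : ∀ σ, ∃ r : ℝ, σ ∈ topCells K → ∀ u ∈ σ, dist u (circumcenter σ) = r := fun σ => by
    by_cases h : σ ∈ topCells K
    · obtain ⟨r, hr⟩ := exists_dist_circumcenter_eq (K.indep h.1)
      exact ⟨r, fun _ => hr⟩
    · exact ⟨0, fun h' => (h h').elim⟩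
  choose r hr using hrad
  -- The function to be minimized, in the form it has on the cell `σ`.
  let f : Finset (EuclideanSpace ℝ (Fin n)) → EuclideanSpace ℝ (Fin n) → ℝ := fun σ y =>
    ‖y - x‖ ^ 2 - ‖y‖ ^ 2 + (‖y - circumcenter σ‖ ^ 2 - r σ ^ 2)
  have hmin : ∀ σ, ∃ y, σ ∈ topCells K → y ∈ convexHull ℝ (σ : Set (EuclideanSpace ℝ (Fin n))) ∧
      ∀ z ∈ convexHull ℝ (σ : Set (EuclideanSpace ℝ (Fin n))), f σ y ≤ f σ z := fun σ => by
    by_cases h : σ ∈ topCells K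
    · have hc : IsCompact (convexHull ℝ (σ : Set (EuclideanSpace ℝ (Fin n)))) :=
        (Finset.finite_toSet σ).isCompact_convexHull ℝ
      have hne : (convexHull ℝ (σ : Set (EuclideanSpace ℝ (Fin n)))).Nonempty :=
        convexHull_nonempty_iff.2 (Finset.coe_nonempty.2 (K.nonempty_of_mem_faces h.1))
      obtain ⟨y, hy, hm⟩ := hc.exists_isMinOn (f := f σ) hne (by fun_prop)
      exact ⟨y, fun _ => ⟨hy, fun z hz => hm hz⟩⟩
    · exact ⟨0, fun h' => (h h').elim⟩
  choose y hy using hmin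
  obtain ⟨σ₀, hσ₀, hbest⟩ := hfin.exists_minimalFor (fun σ => f σ (y σ)) _ ⟨σ₁, hσ₁⟩
  have hbest' : ∀ σ ∈ topCells K, f σ₀ (y σ₀) ≤ f σ (y σ) := fun σ hσ =>
    (le_total _ _).elim id fun h => hbest hσ h
  refine ⟨y σ₀, K.convexHull_subset_space hσ₀.1 (hy σ₀ hσ₀).1, fun σ hσ hyσ u hu => ?_⟩
  -- The expressions for two cells agree at common points, so `t` minimizes on every cell around it.
  have heq : f σ (y σ₀) = f σ₀ (y σ₀) := by
    have h1 := power_le_power hK hσ hσ₀ (hr σ hσ) (hr σ₀ hσ₀) (hy σ₀ hσ₀).1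
    have h2 := power_le_power hK hσ₀ hσ (hr σ₀ hσ₀) (hr σ hσ) hyσ
    simp only [f]
    linarith
  set t := y σ₀
  have hle : ∀ z ∈ convexHull ℝ (σ : Set (EuclideanSpace ℝ (Fin n))),
      ‖t - (x + circumcenter σ)‖ ^ 2 ≤ ‖z - (x + circumcenter σ)‖ ^ 2 := by
    intro z hz
    have h1 : f σ t ≤ f σ z := heq.trans_le ((hbest' σ hσ).trans ((hy σ hσ).2 z hz))
    simp only [f, @norm_sub_sq_real, inner_add_right] at h1 ⊢
    linarith
  -- The first variation along the segment from `t` to `u`.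
  by_contra! hpos
  set a := inner ℝ (x + circumcenter σ - t) (u - t) with ha
  set s := min 1 (a / (‖u - t‖ ^ 2 + 1)) with hs
  have hs0 : 0 < s := lt_min one_pos (by positivity)
  have hs1 : s ≤ 1 := min_le_left _ _
  have hs2 : s * (‖u - t‖ ^ 2 + 1) ≤ a := by
    rw [← le_div_iff₀ (by positivity)]
    exact min_le_right _ _
  have h1 := hle _ ((convex_convexHull ℝ _).add_smul_sub_mem hyσ hu ⟨hs0.le, hs1⟩)
  have h2 : t + s • (u - t) - (x + circumcenter σ) =
      s • (u - t) - (x + circumcenter σ - t) := by abel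
  rw [h2, norm_sub_sq_real (s • (u - t)), norm_smul, inner_smul_left, real_inner_comm, ← ha,
    norm_sub_rev t, mul_pow, Real.norm_of_nonneg hs0.le] at h1
  simp only [conj_trivial] at h1
  nlinarith

end TopCells

/-! ### Strata as sets of points with a critical point in a given open cell -/

section Strata

variable {n : ℕ} {V : Finset (EuclideanSpace ℝ (Fin n))}
  {K : Geometry.SimplicialComplex ℝ (EuclideanSpace ℝ (Fin n))}

theorem intrinsicInterior_image_sub (C : Set (EuclideanSpace ℝ (Fin n)))
    (c : EuclideanSpace ℝ (Fin n)) :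
    intrinsicInterior ℝ ((fun y => y - c) '' C) = (fun y => y - c) '' intrinsicInterior ℝ C := by
  have h : (fun y : EuclideanSpace ℝ (Fin n) => y - c) =
      AffineIsometryEquiv.vaddConst ℝ (P := EuclideanSpace ℝ (Fin n)) (-c) := by
    funext y
    simp [sub_eq_add_neg]
  rw [h]
  exact AffineIsometry.intrinsicInterior_image
    (AffineIsometryEquiv.vaddConst ℝ (P := EuclideanSpace ℝ (Fin n)) (-c)).toAffineIsometry C

/-- Membership in one of the Minkowski sums defining a stratum, undoing the translation: the
nearest point of `σ` to `x + circumcenter σ` lies in the relative interior of `τ`. -/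
theorem mem_intrinsicInterior_add_faceNormalCone_iff {τ σ : Finset (EuclideanSpace ℝ (Fin n))}
    (hτσ : τ ⊆ σ) {x : EuclideanSpace ℝ (Fin n)} :
    x ∈ intrinsicInterior ℝ (recentredFace τ σ) +
        faceNormalCone (recentredSimplex σ) (recentredFace τ σ) ↔
      ∃ t ∈ intrinsicInterior ℝ (convexHull ℝ (τ : Set (EuclideanSpace ℝ (Fin n)))),
        ∀ u ∈ convexHull ℝ (σ : Set (EuclideanSpace ℝ (Fin n))),
          inner ℝ (x + circumcenter σ - t) (u - t) ≤ 0 := by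
  have hsub : convexHull ℝ (τ : Set (EuclideanSpace ℝ (Fin n))) ⊆ convexHull ℝ (σ : Set _) :=
    convexHull_mono (Finset.coe_subset.2 hτσ)
  rw [Set.mem_add]
  simp only [recentredSimplex, recentredFace, faceNormalCone, normalCone,
    intrinsicInterior_image_sub, Set.mem_ofPred_eq, Set.forall_mem_image, Set.exists_mem_image,
    sub_sub_sub_cancel_right]
  refine exists_congr fun t => and_congr_right fun ht => ⟨?_, fun h => ?_⟩
  · rintro ⟨ν, hν, hx⟩ u hu
    have : x + circumcenter σ - t = ν := by
      rw [← hx]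
      abel
    rw [this]
    exact hν ht hu
  · refine ⟨x + circumcenter σ - t, fun p hp u hu => ?_, by abel⟩
    -- A normal at `t` is orthogonal to the face, since `t` lies in the relative interior.
    have h0 : 0 ≤ inner ℝ (x + circumcenter σ - t) (p - t) := by
      obtain ⟨ε, hε, hy⟩ := exists_prolong_mem ht (intrinsicInterior_subset hp)
      have := h _ (hsub hy)
      rw [add_sub_cancel_left, inner_smul_right] at this
      have h2 := nonpos_of_mul_nonpos_right this hε
      rw [← neg_sub p t, inner_neg_right] at h2
      linarith
    have h1 := h u hu
    rw [← sub_sub_sub_cancel_right u p t, inner_sub_right]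
    linarith

/-- The stratum of `τ` consists of the points whose critical point lies in the open cell of `τ`. -/
theorem mem_stratum_iff (hrank : HasFullRank V) (hK : IsAntiDelaunay V K)
    {τ : Finset (EuclideanSpace ℝ (Fin n))} (hτ : τ ∈ K.faces) {x : EuclideanSpace ℝ (Fin n)} :
    x ∈ stratum K τ ↔
      ∃ t ∈ intrinsicInterior ℝ (convexHull ℝ (τ : Set (EuclideanSpace ℝ (Fin n)))),
        IsCritical K x t := by
  have hmem : x ∈ stratum K τ ↔ ∀ σ ∈ topCells K, τ ⊆ σ →
      ∃ t ∈ intrinsicInterior ℝ (convexHull ℝ (τ : Set (EuclideanSpace ℝ (Fin n)))),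
        ∀ u ∈ convexHull ℝ (σ : Set (EuclideanSpace ℝ (Fin n))),
          inner ℝ (x + circumcenter σ - t) (u - t) ≤ 0 := by
    simp only [stratum, Set.mem_iInter₂]
    exact ⟨fun h σ hσ hτσ =>
        (mem_intrinsicInterior_add_faceNormalCone_iff hτσ).1 (h σ ⟨hσ.1, hσ.2, hτσ⟩),
      fun h σ hσ => (mem_intrinsicInterior_add_faceNormalCone_iff hσ.2.2).2
        (h σ ⟨hσ.1, hσ.2.1⟩ hσ.2.2)⟩
  have hsub : ∀ {σ : Finset (EuclideanSpace ℝ (Fin n))}, τ ⊆ σ →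
      intrinsicInterior ℝ (convexHull ℝ (τ : Set (EuclideanSpace ℝ (Fin n)))) ⊆
        convexHull ℝ (σ : Set _) := fun h =>
    intrinsicInterior_subset.trans (convexHull_mono (Finset.coe_subset.2 h))
  rw [hmem]
  constructor
  · intro h
    obtain ⟨p, hp⟩ := Set.Nonempty.intrinsicInterior
      (convex_convexHull ℝ (τ : Set (EuclideanSpace ℝ (Fin n))))
      (convexHull_nonempty_iff.2 (Finset.coe_nonempty.2 (K.nonempty_of_mem_faces hτ)))
    obtain ⟨σ₀, hσ₀, hpσ₀⟩ := exists_topCell_mem hrank hK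
      (K.convexHull_subset_space hτ (intrinsicInterior_subset hp))
    have hτσ₀ := face_subset_of_mem_intrinsicInterior hτ hσ₀.1 hp hpσ₀
    obtain ⟨t, ht, hc⟩ := h σ₀ hσ₀ hτσ₀
    refine ⟨t, ht, fun σ hσ htσ => ?_⟩
    have hτσ := face_subset_of_mem_intrinsicInterior hτ hσ.1 ht htσ
    -- The nearest points for the various cells around `τ` agree.
    obtain ⟨t', ht', hc'⟩ := h σ hσ hτσ
    have : t = t' := eq_of_inner_le_zero hK hσ₀ hσ (hsub hτσ₀ ht) (hsub hτσ ht')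
      (hc _ (hsub hτσ₀ ht')) (hc' _ (hsub hτσ ht))
    rw [this]
    exact hc'
  · rintro ⟨t, ht, hc⟩ σ hσ hτσ
    exact ⟨t, ht, hc σ hσ (hsub hτσ ht)⟩

end Strata

/-! ### Vertices and the complement of the multi-plank -/

section Plank

variable {n : ℕ} {V : Finset (EuclideanSpace ℝ (Fin n))}
  {K : Geometry.SimplicialComplex ℝ (EuclideanSpace ℝ (Fin n))}

/-- The vertices of a top-dimensional cell are points of `V`: they lie on the boundary of a ball
containing `V`. -/
theorem mem_of_mem_topCell (hK : IsAntiDelaunay V K) {σ : Finset (EuclideanSpace ℝ (Fin n))}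
    (hσ : σ ∈ topCells K) {v : EuclideanSpace ℝ (Fin n)} (hv : v ∈ σ) : v ∈ V := by
  obtain ⟨r, hr⟩ := exists_dist_circumcenter_eq (K.indep hσ.1)
  have hball := hK.full_sphere σ hσ.1 hσ.2 _ r hr
  have hvV : v ∈ convexHull ℝ (V : Set (EuclideanSpace ℝ (Fin n))) :=
    hK.space_eq ▸ K.subset_space hσ.1 hv
  have hconv : ConvexOn ℝ Set.univ fun y : EuclideanSpace ℝ (Fin n) =>
      inner ℝ (v - circumcenter σ) y :=
    (innerₛₗ ℝ (v - circumcenter σ)).convexOn convex_univ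
  obtain ⟨w, hw, hle⟩ := hconv.exists_ge_of_mem_convexHull (Set.subset_univ _) hvV
  have h1 := hball hw
  have h2 := hr v hv
  rw [Metric.mem_closedBall, dist_eq_norm] at h1
  rw [dist_eq_norm] at h2
  have h3 : ‖w - circumcenter σ‖ ^ 2 ≤ r ^ 2 := by gcongr
  have h4 : ‖w - circumcenter σ - (v - circumcenter σ)‖ ^ 2 ≤ 0 := by
    have h5 : inner ℝ (v - circumcenter σ) (w - circumcenter σ) ≥ r ^ 2 := by
      rw [← h2, ← real_inner_self_eq_norm_sq, inner_sub_right, inner_sub_right _ v]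
      linarith
    rw [@norm_sub_sq_real, real_inner_comm, h2]
    linarith
  have h6 : w - v = 0 := by
    rw [← norm_eq_zero, ← sub_sub_sub_cancel_right w v (circumcenter σ)]
    exact pow_eq_zero_iff two_ne_zero |>.1 (le_antisymm h4 (sq_nonneg _))
  rw [← sub_eq_zero.1 h6]
  exact hw

theorem norm_add_sub_le_iff {x v w : EuclideanSpace ℝ (Fin n)} :
    ‖x - v + w‖ ≤ ‖x‖ ↔ 2 * inner ℝ x (w - v) + ‖w - v‖ ^ 2 ≤ 0 := by
  rw [← sq_le_sq₀ (norm_nonneg _) (norm_nonneg _), sub_add_eq_add_sub, add_sub_assoc,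
    norm_add_sq_real]
  constructor <;> intro h <;> linarith

theorem notMem_openMultiPlank_iff {x : EuclideanSpace ℝ (Fin n)} :
    x ∉ openMultiPlank V ↔
      ∃ v ∈ V, ∀ w ∈ V, 2 * inner ℝ x (w - v) + ‖w - v‖ ^ 2 ≤ 0 := by
  simp only [openMultiPlank, Set.mem_ofPred_eq, not_forall, not_exists, not_and, not_lt,
    norm_add_sub_le_iff, exists_prop]

/-- The defining inequality of the complement of the multi-plank extends to `conv V`. -/
theorem inner_add_sq_le_of_mem_convexHull {x v : EuclideanSpace ℝ (Fin n)}
    (h : ∀ w ∈ V, 2 * inner ℝ x (w - v) + ‖w - v‖ ^ 2 ≤ 0) {w : EuclideanSpace ℝ (Fin n)}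
    (hw : w ∈ convexHull ℝ (V : Set (EuclideanSpace ℝ (Fin n)))) :
    2 * inner ℝ x (w - v) + ‖w - v‖ ^ 2 ≤ 0 := by
  have : convexHull ℝ (V : Set (EuclideanSpace ℝ (Fin n))) ⊆ Metric.closedBall (v - x) ‖x‖ := by
    refine convexHull_min (fun y hy => ?_) (convex_closedBall _ _)
    have := norm_add_sub_le_iff.2 (h y hy)
    rwa [Metric.mem_closedBall, dist_eq_norm, show y - (v - x) = x - v + y by abel]
  have h2 := this hw
  rwa [Metric.mem_closedBall, dist_eq_norm, show w - (v - x) = x - v + w by abel,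
    norm_add_sub_le_iff] at h2

/-- If a vertex is the critical point of `x`, then `x` is outside the multi-plank. -/
theorem IsCritical.notMem_openMultiPlank (hrank : HasFullRank V) (hK : IsAntiDelaunay V K)
    {x v : EuclideanSpace ℝ (Fin n)} (hv : {v} ∈ K.faces) (h : IsCritical K x v) :
    x ∉ openMultiPlank V := by
  have hvK : v ∈ K.space := K.subset_space hv (by simp)
  have hvert : ∀ σ ∈ topCells K, v ∈ convexHull ℝ (σ : Set (EuclideanSpace ℝ (Fin n))) → v ∈ σ :=
    fun σ hσ => (Geometry.SimplicialComplex.vertex_mem_convexHull_iff hv hσ.1).1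
  obtain ⟨σ₀, hσ₀, hvσ₀⟩ := exists_topCell_mem hrank hK hvK
  refine notMem_openMultiPlank_iff.2
    ⟨v, mem_of_mem_topCell hK hσ₀ (hvert σ₀ hσ₀ hvσ₀), fun w hw => ?_⟩
  have hwK : w ∈ K.space := hK.space_eq ▸ subset_convexHull ℝ _ hw
  obtain ⟨σ, hσ, hvσ, hle⟩ := h.exists_topCell_inner_le hrank hK hvK hwK
  obtain ⟨r, hr⟩ := exists_dist_circumcenter_eq (K.indep hσ.1)
  have h1 := hK.full_sphere σ hσ.1 hσ.2 _ r hr hw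
  have h2 := hr v (hvert σ hσ hvσ)
  rw [Metric.mem_closedBall, dist_eq_norm] at h1
  rw [dist_eq_norm] at h2
  have h3 : ‖w - circumcenter σ‖ ^ 2 ≤ ‖v - circumcenter σ‖ ^ 2 := by
    rw [h2]
    gcongr
  have h4 : w - circumcenter σ = (w - v) + (v - circumcenter σ) := by abel
  rw [h4, norm_add_sq_real, real_inner_comm] at h3
  have h5 : x + circumcenter σ - v = x - (v - circumcenter σ) := by abel
  rw [h5, inner_sub_left] at hle
  linarith

/-- If `x` is outside the multi-plank because of `v`, then `v` is the critical point of `x`. -/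
theorem IsCritical.eq_of_inner_add_sq_le (hrank : HasFullRank V) (hK : IsAntiDelaunay V K)
    {x t v : EuclideanSpace ℝ (Fin n)} (hc : IsCritical K x t) (ht : t ∈ K.space) (hv : v ∈ V)
    (h : ∀ w ∈ V, 2 * inner ℝ x (w - v) + ‖w - v‖ ^ 2 ≤ 0) : t = v := by
  obtain ⟨σ, hσ, htσ, hle⟩ := hc.exists_topCell_inner_le hrank hK ht
    (hK.space_eq ▸ subset_convexHull ℝ _ hv : v ∈ K.space)
  obtain ⟨r, hr⟩ := exists_dist_circumcenter_eq (K.indep hσ.1)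
  set c := circumcenter σ
  have h1 : ‖v - c‖ ^ 2 ≤ r ^ 2 := by
    have := hK.full_sphere σ hσ.1 hσ.2 _ r hr hv
    rw [Metric.mem_closedBall, dist_eq_norm] at this
    gcongr
  -- Interpolating the hypothesis from the vertices of `σ`, where `‖u - c‖ ^ 2 = r ^ 2`.
  have hhalf : convexHull ℝ (σ : Set (EuclideanSpace ℝ (Fin n))) ⊆
      {y | inner ℝ (x + c - v) y ≤
        inner ℝ (x + c - v) v - (r ^ 2 - ‖v - c‖ ^ 2) / 2} := by
    refine convexHull_min (fun u hu => ?_) (convex_halfSpace_le (innerₛₗ ℝ (x + c - v)).isLinear _)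
    have h2 := h u (mem_of_mem_topCell hK hσ hu)
    have h3 := hr u hu
    rw [dist_eq_norm] at h3
    have h4 : u - c = (u - v) + (v - c) := by abel
    have h5 : ‖u - c‖ ^ 2 = r ^ 2 := by rw [h3]
    rw [h4, norm_add_sq_real, real_inner_comm] at h5
    have h6 : inner ℝ (x + c - v) (u - v) = inner ℝ x (u - v) - inner ℝ (v - c) (u - v) := by
      rw [← inner_sub_left]
      congr 1
      abel
    rw [inner_sub_right] at h6
    rw [Set.mem_ofPred_eq]
    linarith
  have h2 := hhalf htσ
  rw [Set.mem_ofPred_eq] at h2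
  have h3 : inner ℝ (x + c - t) (v - t) =
      inner ℝ (x + c - v) v - inner ℝ (x + c - v) t + ‖v - t‖ ^ 2 := by
    rw [← inner_sub_right, ← real_inner_self_eq_norm_sq, ← inner_add_left]
    congr 1
    abel
  have h4 : ‖v - t‖ ^ 2 = 0 := le_antisymm (by linarith) (sq_nonneg _)
  exact (sub_eq_zero.1 (norm_eq_zero.1 (pow_eq_zero_iff two_ne_zero |>.1 h4))).symm

/-- A point `v` as in the complement of the multi-plank is extreme in `conv V`, so it is not in the
open cell of any `τ` with at least two vertices. -/
theorem card_le_one_of_inner_add_sq_le (hK : IsAntiDelaunay V K)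
    {τ : Finset (EuclideanSpace ℝ (Fin n))} (hτ : τ ∈ K.faces) {x v : EuclideanSpace ℝ (Fin n)}
    (hv : v ∈ intrinsicInterior ℝ (convexHull ℝ (τ : Set (EuclideanSpace ℝ (Fin n)))))
    (h : ∀ w ∈ V, 2 * inner ℝ x (w - v) + ‖w - v‖ ^ 2 ≤ 0) : τ.card ≤ 1 := by
  suffices hall : ∀ u ∈ τ, u = v from
    Finset.card_le_one.2 fun a ha b hb => (hall a ha).trans (hall b hb).symm
  intro u hu
  have hsub := K.convexHull_subset_space hτ
  rw [hK.space_eq] at hsub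
  have huτ := subset_convexHull ℝ (τ : Set (EuclideanSpace ℝ (Fin n))) (Finset.mem_coe.2 hu)
  obtain ⟨ε, hε, hy⟩ := exists_prolong_mem hv huτ
  have h1 := inner_add_sq_le_of_mem_convexHull h (hsub huτ)
  have h2 := inner_add_sq_le_of_mem_convexHull h (hsub hy)
  rw [add_sub_cancel_left, inner_smul_right, ← neg_sub, inner_neg_right] at h2
  have h3 : 0 ≤ inner ℝ x (u - v) := by
    by_contra! hneg
    nlinarith [sq_nonneg ‖ε • -(u - v)‖, mul_pos hε (neg_pos.2 hneg)]
  have h4 : ‖u - v‖ ^ 2 = 0 := le_antisymm (by linarith) (sq_nonneg _)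
  exact sub_eq_zero.1 (norm_eq_zero.1 (pow_eq_zero_iff two_ne_zero |>.1 h4))

end Plank

end MultiPlank

theorem theorem4p4 {n : ℕ} (V : Finset (EuclideanSpace ℝ (Fin n)))
    (hV : MultiPlank.IsCenteredGeneratingSet V) (hrank : MultiPlank.HasFullRank V)
    (K : Geometry.SimplicialComplex ℝ (EuclideanSpace ℝ (Fin n)))
    (hK : MultiPlank.IsAntiDelaunay V K) :
    (MultiPlank.openMultiPlank V =
        ⋃ d ∈ Finset.Icc 1 n, ⋃ τ ∈ {τ | τ ∈ K.faces ∧ τ.card = d + 1}, MultiPlank.stratum K τ) ∧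
      {τ | τ ∈ K.faces ∧ 2 ≤ τ.card}.PairwiseDisjoint (MultiPlank.stratum K) := by
  constructor
  · ext x
    simp only [Set.mem_iUnion, Set.mem_ofPred_eq, exists_prop, Finset.mem_Icc]
    constructor
    · intro hx
      obtain ⟨t, ht, hc⟩ := MultiPlank.exists_isCritical hrank hK x
      obtain ⟨τ, hτ, htτ⟩ := MultiPlank.exists_face_mem_intrinsicInterior ht
      have hcard : τ.card ≠ 1 := by
        intro h1
        obtain ⟨v, rfl⟩ := Finset.card_eq_one.1 h1
        rw [Finset.coe_singleton, convexHull_singleton, intrinsicInterior_singleton,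
          Set.mem_singleton_iff] at htτ
        subst htτ
        exact hc.notMem_openMultiPlank hrank hK hτ hx
      have hpos := (K.nonempty_of_mem_faces hτ).card_pos
      have hle := MultiPlank.card_face_le hτ
      exact ⟨τ.card - 1, ⟨by omega, by omega⟩, τ, ⟨hτ, by omega⟩,
        (MultiPlank.mem_stratum_iff hrank hK hτ).2 ⟨t, htτ, hc⟩⟩
    · rintro ⟨d, ⟨hd, -⟩, τ, ⟨hτ, hcard⟩, hx⟩
      obtain ⟨t, htτ, hc⟩ := (MultiPlank.mem_stratum_iff hrank hK hτ).1 hx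
      by_contra hxP
      obtain ⟨v, hv, h⟩ := MultiPlank.notMem_openMultiPlank_iff.1 hxP
      have htv := hc.eq_of_inner_add_sq_le hrank hK
        (K.convexHull_subset_space hτ (intrinsicInterior_subset htτ)) hv h
      subst htv
      have := MultiPlank.card_le_one_of_inner_add_sq_le hK hτ htτ h
      omega
  · rintro τ ⟨hτ, -⟩ τ' ⟨hτ', -⟩ hne
    refine Set.disjoint_left.2 fun x hx hx' => hne ?_
    obtain ⟨t, ht, hc⟩ := (MultiPlank.mem_stratum_iff hrank hK hτ).1 hx
    obtain ⟨t', ht', hc'⟩ := (MultiPlank.mem_stratum_iff hrank hK hτ').1 hx'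
    have htt' := hc.unique hrank hK hc'
      (K.convexHull_subset_space hτ (intrinsicInterior_subset ht))
      (K.convexHull_subset_space hτ' (intrinsicInterior_subset ht'))
    subst htt'
    exact (MultiPlank.face_subset_of_mem_intrinsicInterior hτ hτ' ht
      (intrinsicInterior_subset ht')).antisymm
      (MultiPlank.face_subset_of_mem_intrinsicInterior hτ' hτ ht' (intrinsicInterior_subset ht))
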